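/- Terms are generated by $M ::= x \mid \lambda x.M \mid MM \mid M\oplus M \mid \Omega$ and contexts by $C ::= [\cdot]\mid M\mid \lambda x.C\mid CM\mid MC\mid C\oplus C$. The affine judgement $\Gamma\vdash M$ ($\Gamma$ a finite set of variables) has the rules: $\Gamma,x\vdash x$; $\Gamma\vdash\Omega$; if $\Gamma,x\vdash M$ then $\Gamma\vdash\lambda x.M$; if $\Gamma\vdash M$ and $\Delta\vdash N$ with $\Gamma,\Delta$ disjoint then $\Gamma,\Delta\vdash MN$; if $\Gamma\vdash M$ and $\Gamma\vdash N$ then $\Gamma\vdash M\oplus N$. The same rules, together with $\Gamma\vdash[\cdot]$, define affine contexts. A program is a term $M$ with $\emptyset\vdash M$; a value is a program of the form $\lambda x.L$. The call-by-value semantics $[\![M]\!]$ of a program $M$ is the unique value subdistribution $\mathscr D$ with $M\Downarrow\mathscr D$, where $\Downarrow$ is given inductively by: $\Omega\Downarrow\emptyset$; $V\Downarrow\{V^1\}$ for a value $V$; if $M\Downarrow\mathscr D$ and $N\Downarrow\mathscr E$ then $M\oplus N\Downarrow\frac12\mathscr D+\frac12\mathscr E$; and if moreover $L\{V/x\}\Downarrow\mathscr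 F_{L,V}$ for all $\lambda x.L$ in the support of $\mathscr D$ and all $V$ in the support of $\mathscr E$, then $MN\Downarrow\sum\mathscr D(\lambda x.L)\,\mathscr E(V)\,\mathscr F_{L,V}$. The convergence probability of $M$ is $\sum[\![M]\!]=\sum_V[\![M]\!](V)$. For programs $M,N$, with $C$ ranging over the affine contexts $\emptyset\vdash C$, put $$\delta^{\mathrm{ctx}}(M,N)=\sup_C\Bigl|\textstyle\sum[\![C[M]]\!]-\sum[\![C[N]]\!]\Bigr|,\qquad M\le^{\mathrm{ctx}}N\iff\forall C:\ \textstyle\sum[\![C[M]]\!]\le\sum[\![C[N]]\!],$$ and let $M\equiv^{\mathrm{ctx}}N$ mean $M\le^{\mathrm{ctx}}N$ and $N\le^{\mathrm{ctx}}M$. A trace is a finite, possibly empty, sequence $s=@V_1\cdots @V_n$ of values. The probability $\Pr(M,s)$ that a program $M$ accepts $s$ is defined by $\Pr(\lambda x.L,\epsilon)=1$, $\Pr(\lambda x.L,@V\cdot s)=\Pr(L\{V/x\},s)$, and $\Pr(M,s)=\sum_V[\![M]\!](V)\Pr(V,s)$ if $M$ is not a value. Put $$\delta^{\mathrm{tr}}(M,N)=\sup_s|\Pr(M,s)-\Pr(N,s)|,$$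 $M\le^{\mathrm{tr}}N\iff\Pr(M,s)\le\Pr(N,s)$ for all traces $s$, and $M\equiv^{\mathrm{tr}}N\iff\Pr(M,s)=\Pr(N,s)$ for all traces $s$. **Theorem.** For all programs $M$ and $N$: $\delta^{\mathrm{ctx}}(M,N)=\delta^{\mathrm{tr}}(M,N)$; $M\le^{\mathrm{ctx}}N$ if and only if $M\le^{\mathrm{tr}}N$; and $M\equiv^{\mathrm{ctx}}N$ if and only if $M\equiv^{\mathrm{tr}}N$. -/

import Mathlib

open scoped ENNReal

namespace AffineLambda

/-- Terms `x | λx.M | M N | M ⊕ N | Ω`, with `ℕ` as the countable set of variables.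
Terms are kept as raw named syntax: only closed terms are ever substituted or put in a hole,
so no variable capture can occur and nothing below depends on the names of bound variables. -/
inductive Term : Type
  | var (x : ℕ) : Term
  | lam (x : ℕ) (M : Term) : Term
  | app (M N : Term) : Term
  | choice (M N : Term) : Term
  | omega : Term

/-- `M.subst x V` is `M{V/x}`, for a closed term `V`. -/
def Term.subst : Term → ℕ → Term → Term
  | .var y, x, V => if y = x then V else .var y
  | .lam y M, x, V => if y = x then .lam y M else .lam y (M.subst x V)
  | .app M N, x, V => .app (M.subst x V) (N.subst x V)
  | .choice M N, x, V => .choice (M.subst x V) (N.subst x V)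
  | .omega, _, _ => .omega

/-- The affine formation judgement `Γ ⊢ M`. In the rule for `λx.M` the variable `x` may already
occur in `Γ`; it is then shadowed, which agrees with first renaming the bound `x`. -/
inductive Affine : Finset ℕ → Term → Prop
  | var {Γ : Finset ℕ} {x : ℕ} : x ∈ Γ → Affine Γ (.var x)
  | lam {Γ : Finset ℕ} {x : ℕ} {M : Term} : Affine (insert x Γ) M → Affine Γ (.lam x M)
  | app {Γ Δ : Finset ℕ} {M N : Term} :
      Disjoint Γ Δ → Affine Γ M → Affine Δ N → Affine (Γ ∪ Δ) (.app M N)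
  | choice {Γ : Finset ℕ} {M N : Term} : Affine Γ M → Affine Γ N → Affine Γ (.choice M N)
  | omega {Γ : Finset ℕ} : Affine Γ .omega

theorem Affine.lam_inv {Γ : Finset ℕ} {x : ℕ} {M : Term} (h : Affine Γ (.lam x M)) :
    Affine (insert x Γ) M := by
  generalize hP : Term.lam x M = P at h
  cases h <;> cases hP
  assumption

theorem Affine.choice_inv {Γ : Finset ℕ} {M N : Term} (h : Affine Γ (.choice M N)) :
    Affine Γ M ∧ Affine Γ N := by
  generalize hP : Term.choice M N = P at h
  cases h <;> cases hP
  constructor <;> assumption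

theorem Affine.app_inv {M N : Term} (h : Affine ∅ (.app M N)) : Affine ∅ M ∧ Affine ∅ N := by
  generalize hP : Term.app M N = P at h
  generalize hΓ : (∅ : Finset ℕ) = Γ at h
  cases h with
  | app _ h1 h2 =>
    cases hP
    obtain ⟨e1, e2⟩ := Finset.union_eq_empty.1 hΓ.symm
    subst e1 e2
    exact ⟨h1, h2⟩
  | var | lam | choice | omega => cases hP

theorem Affine.not_var {x : ℕ} (h : Affine ∅ (.var x)) : False := by
  generalize hP : Term.var x = P at h
  generalize hΓ : (∅ : Finset ℕ) = Γ at h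
  cases h with
  | var hx => subst hΓ; simp at hx
  | app | lam | choice | omega => cases hP

theorem Affine.weaken {Γ : Finset ℕ} {M : Term} (h : Affine Γ M) :
    ∀ {Γ' : Finset ℕ}, Γ ⊆ Γ' → Affine Γ' M := by
  induction h with
  | var hx => intro Γ' hs; exact .var (hs hx)
  | lam _ ih => intro Γ' hs; exact .lam (ih (Finset.insert_subset_insert _ hs))
  | @app Γ Δ M N hd _ _ ihM ihN =>
    intro Γ' hs
    have hΓ : Γ ⊆ Γ' := Finset.union_subset_left hs
    have hΔ : Δ ⊆ Γ' \ Γ := by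
      intro a ha
      exact Finset.mem_sdiff.2 ⟨hs (Finset.mem_union_right _ ha),
        fun h' => Finset.disjoint_left.1 hd h' ha⟩
    have := Affine.app (Finset.disjoint_sdiff (s := Γ) (t := Γ')) (ihM (le_refl _)) (ihN hΔ)
    rwa [Finset.union_sdiff_of_subset hΓ] at this
  | choice _ _ ihM ihN => intro Γ' hs; exact .choice (ihM hs) (ihN hs)
  | omega => intro Γ' _; exact .omega

theorem Affine.subst {Γ : Finset ℕ} {M : Term} (h : Affine Γ M) (x : ℕ) {V : Term}
    (hV : Affine ∅ V) : Affine (Γ.erase x) (M.subst x V) := by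
  induction h with
  | @var Γ y hy =>
    unfold Term.subst
    split_ifs with hyx
    · exact hV.weaken (Finset.empty_subset _)
    · exact .var (Finset.mem_erase.2 ⟨hyx, hy⟩)
  | @lam Γ y M hM ih =>
    unfold Term.subst
    split_ifs with hyx
    · subst hyx
      refine .lam (hM.weaken ?_)
      intro a ha
      simp only [Finset.mem_insert, Finset.mem_erase] at ha ⊢
      tauto
    · refine .lam ?_
      rwa [Finset.erase_insert_of_ne hyx] at ih
  | app hd _ _ ihM ihN =>
    rw [Finset.erase_union_distrib]
    exact .app (hd.mono (Finset.erase_subset _ _) (Finset.erase_subset _ _)) ihM ihN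
  | choice _ _ ihM ihN => exact .choice ihM ihN
  | omega => exact .omega

/-- Programs: terms `M` with `∅ ⊢ M`. -/
def Program : Type := {M : Term // Affine ∅ M}

/-- Values: programs of the form `λx.L`. -/
@[ext] structure Value : Type where
  binder : ℕ
  body : Term
  affine : Affine ∅ (.lam binder body)

def Value.toProgram (V : Value) : Program := ⟨.lam V.binder V.body, V.affine⟩

def Program.app (M N : Program) : Program :=
  ⟨.app M.1 N.1, .app (Finset.disjoint_empty_left ∅) M.2 N.2⟩

def Program.choice (M N : Program) : Program := ⟨.choice M.1 N.1, .choice M.2 N.2⟩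

def Program.omega : Program := ⟨.omega, .omega⟩

/-- For `V = λx.L`, the program `L{W/x}`. -/
def Value.apply (V W : Value) : Program :=
  ⟨V.body.subst V.binder W.toProgram.1, by
    have hL : Affine (insert V.binder ∅) V.body := V.affine.lam_inv
    have := hL.subst V.binder W.toProgram.2
    simpa using this⟩

/-- Functions from values to `[0,∞]`. The ones that the semantics assigns to programs are value
subdistributions, see `BigStep.weight_le_one`. -/
abbrev ValueDist : Type := Value → ℝ≥0∞

open Classical in
/-- The Dirac value distribution `{V¹}`. -/
noncomputable def dirac (V : Value) : ValueDist := fun U => if U = V then 1 else 0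

/-- Big-step call-by-value evaluation `M ⇓ 𝒟`. -/
inductive BigStep : Program → ValueDist → Prop
  | omega : BigStep Program.omega (fun _ => 0)
  | value (V : Value) : BigStep V.toProgram (dirac V)
  | choice {M N : Program} {D E : ValueDist} : BigStep M D → BigStep N E →
      BigStep (M.choice N) (fun U => 2⁻¹ * D U + 2⁻¹ * E U)
  | app {M N : Program} {D E : ValueDist} {F : Value → Value → ValueDist} :
      BigStep M D → BigStep N E →
      (∀ V W : Value, D V ≠ 0 → E W ≠ 0 → BigStep (V.apply W) (F V W)) →
      BigStep (M.app N) (fun U => ∑' V : Value, ∑' W : Value, D V * E W * F V W U)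

/-! ### Evaluation is a function -/

theorem Program.app_inj {M N M' N' : Program} (h : M.app N = M'.app N') : M = M' ∧ N = N' := by
  have := congrArg Subtype.val h
  simp only [Program.app, Term.app.injEq] at this
  exact ⟨Subtype.ext this.1, Subtype.ext this.2⟩

theorem Program.choice_inj {M N M' N' : Program} (h : M.choice N = M'.choice N') :
    M = M' ∧ N = N' := by
  have := congrArg Subtype.val h
  simp only [Program.choice, Term.choice.injEq] at this
  exact ⟨Subtype.ext this.1, Subtype.ext this.2⟩

theorem Value.toProgram_inj {V W : Value} (h : V.toProgram = W.toProgram) : V = W := by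
  have := congrArg Subtype.val h
  simp only [Value.toProgram, Term.lam.injEq] at this
  exact Value.ext this.1 this.2

theorem BigStep.unique {M : Program} {D : ValueDist} (h : BigStep M D) :
    ∀ {D' : ValueDist}, BigStep M D' → D = D' := by
  induction h with
  | omega =>
    intro D' h'
    generalize hP : Program.omega = P at h'
    cases h' with
    | omega => rfl
    | value | choice | app => cases congrArg Subtype.val hP
  | value V =>
    intro D' h'
    generalize hP : V.toProgram = P at h'
    cases h' with
    | value W => rw [Value.toProgram_inj hP]
    | omega | choice | app => cases congrArg Subtype.val hP
  | choice _ _ ihM ihN =>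
    intro D' h'
    generalize hP : Program.choice _ _ = P at h'
    cases h' with
    | choice hM hN =>
      obtain ⟨rfl, rfl⟩ := Program.choice_inj hP
      rw [ihM hM, ihN hN]
    | omega | value | app => cases congrArg Subtype.val hP
  | @app M N D E F _ _ _ ihM ihN ihF =>
    intro D' h'
    generalize hP : Program.app _ _ = P at h'
    cases h' with
    | app hM hN hF =>
      obtain ⟨rfl, rfl⟩ := Program.app_inj hP
      obtain rfl := ihM hM
      obtain rfl := ihN hN
      funext U
      refine tsum_congr fun V => tsum_congr fun W => ?_
      by_cases hV : D V = 0
      · rw [hV]; simp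
      by_cases hW : E W = 0
      · rw [hW]; simp
      rw [ihF V W hV hW (hF V W hV hW)]
    | omega | value | choice => cases congrArg Subtype.val hP

theorem Affine.subst_eq_self {Γ : Finset ℕ} {M : Term} (h : Affine Γ M) {x : ℕ} (hx : x ∉ Γ)
    (V : Term) : M.subst x V = M := by
  induction h with
  | @var Γ y hy =>
    have : y ≠ x := fun e => hx (e ▸ hy)
    simp [Term.subst, this]
  | @lam Γ y M _ ih =>
    unfold Term.subst
    split_ifs with hyx
    · rfl
    · rw [ih (by simp [hx, Ne.symm hyx])]
  | app _ _ _ ihM ihN =>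
    simp only [Finset.mem_union, not_or] at hx
    simp [Term.subst, ihM hx.1, ihN hx.2]
  | choice _ _ ihM ihN => simp [Term.subst, ihM hx, ihN hx]
  | omega => rfl

/-- A measure that decreases in evaluation; used to see that every program has a semantics. -/
def Term.rank : Term → ℕ
  | .var _ => 1
  | .lam _ M => M.rank + 1
  | .app M N => M.rank + N.rank + 1
  | .choice M N => max M.rank N.rank + 1
  | .omega => 1

theorem Affine.rank_subst_le {Γ : Finset ℕ} {M : Term} (h : Affine Γ M) (x : ℕ) (V : Term) :
    (M.subst x V).rank ≤ M.rank + V.rank := by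
  induction h with
  | @var Γ y hy =>
    unfold Term.subst
    split_ifs <;> simp [Term.rank]
  | @lam Γ y M _ ih =>
    unfold Term.subst
    split_ifs <;> simp only [Term.rank] <;> omega
  | @app Γ Δ M N hd hM hN ihM ihN =>
    simp only [Term.subst, Term.rank]
    by_cases hx : x ∈ Γ
    · rw [hN.subst_eq_self (Finset.disjoint_left.1 hd hx)]; omega
    · rw [hM.subst_eq_self hx]; omega
  | choice _ _ ihM ihN => simp only [Term.subst, Term.rank]; omega
  | omega => simp [Term.subst, Term.rank]

theorem Value.rank_apply_lt (V W : Value) :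
    (V.apply W).1.rank < V.toProgram.1.rank + W.toProgram.1.rank := by
  have hL : Affine (insert V.binder ∅) V.body := V.affine.lam_inv
  have := hL.rank_subst_le V.binder W.toProgram.1
  simp only [Value.apply, Value.toProgram, Term.rank] at this ⊢
  omega

theorem BigStep.exists_of_rank (n : ℕ) : ∀ M : Program, M.1.rank ≤ n →
    ∃ D : ValueDist, BigStep M D ∧ ∀ V : Value, D V ≠ 0 → V.toProgram.1.rank ≤ M.1.rank := by
  induction n with
  | zero => rintro ⟨M, hM⟩ h; cases M <;> simp [Term.rank] at h
  | succ n ih =>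
    rintro ⟨M, hM⟩ h
    cases M with
    | var x => exact hM.not_var.elim
    | omega => exact ⟨_, BigStep.omega, fun V hV => absurd rfl hV⟩
    | lam x L =>
      refine ⟨_, BigStep.value ⟨x, L, hM⟩, fun V hV => ?_⟩
      have : V = ⟨x, L, hM⟩ := by
        by_contra hne
        exact hV (by simp [dirac, hne])
      rw [this]; rfl
    | choice P Q =>
      have hP : Affine ∅ P := hM.choice_inv.1
      have hQ : Affine ∅ Q := hM.choice_inv.2
      simp only [Term.rank] at h
      obtain ⟨D, hD, hDr⟩ := ih ⟨P, hP⟩ (by simp only; omega)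
      obtain ⟨E, hE, hEr⟩ := ih ⟨Q, hQ⟩ (by simp only; omega)
      refine ⟨_, BigStep.choice hD hE, fun V hV => ?_⟩
      simp only [Term.rank]
      by_cases hDV : D V = 0
      · by_cases hEV : E V = 0
        · simp [hDV, hEV] at hV
        · have := hEr V hEV; simp only at this; omega
      · have := hDr V hDV; simp only at this; omega
    | app P Q =>
      obtain ⟨hP, hQ⟩ := hM.app_inv
      simp only [Term.rank] at h
      obtain ⟨D, hD, hDr⟩ := ih ⟨P, hP⟩ (by simp only; omega)
      obtain ⟨E, hE, hEr⟩ := ih ⟨Q, hQ⟩ (by simp only; omega)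
      simp only at hDr hEr
      have key : ∀ V W : Value, ∃ G : ValueDist, D V ≠ 0 → E W ≠ 0 →
          BigStep (V.apply W) G ∧
            ∀ U : Value, G U ≠ 0 → U.toProgram.1.rank ≤ (V.apply W).1.rank := by
        intro V W
        by_cases hc : D V ≠ 0 ∧ E W ≠ 0
        · have h1 := hDr V hc.1
          have h2 := hEr W hc.2
          have h3 := Value.rank_apply_lt V W
          obtain ⟨G, hG⟩ := ih (V.apply W) (by omega)
          exact ⟨G, fun _ _ => hG⟩
        · exact ⟨fun _ => 0, fun a b => absurd ⟨a, b⟩ hc⟩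
      choose F hF using key
      refine ⟨_, BigStep.app hD hE (fun V W hV hW => (hF V W hV hW).1), fun U hU => ?_⟩
      have hU' : ∃ V W, D V * E W * F V W U ≠ 0 := by
        by_contra hcon
        push Not at hcon
        exact hU (by simp [hcon])
      obtain ⟨V, W, hVW⟩ := hU'
      have hV : D V ≠ 0 := fun e => hVW (by simp [e])
      have hW : E W ≠ 0 := fun e => hVW (by simp [e])
      have hFU : F V W U ≠ 0 := fun e => hVW (by simp [e])
      have h1 := hDr V hV
      have h2 := hEr W hW
      have h3 := Value.rank_apply_lt V W
      have h4 := (hF V W hV hW).2 U hFU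
      simp only [Term.rank]
      omega

/-- Every program evaluates to exactly one value distribution. -/
theorem BigStep.existsUnique (M : Program) : ∃! D : ValueDist, BigStep M D := by
  obtain ⟨D, hD, _⟩ := BigStep.exists_of_rank _ M le_rfl
  exact ⟨D, hD, fun D' h' => h'.unique hD⟩

/-- The semantics `⟦M⟧`: the unique value distribution with `M ⇓ ⟦M⟧`. -/
noncomputable def sem (M : Program) : ValueDist := (BigStep.existsUnique M).choose

theorem sem_spec (M : Program) : BigStep M (sem M) := (BigStep.existsUnique M).choose_spec.1

theorem BigStep.weight_le_one {M : Program} {D : ValueDist} (h : BigStep M D) :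
    ∑' V : Value, D V ≤ 1 := by
  induction h with
  | omega => simp
  | value V => simp [dirac]
  | choice _ _ ihM ihN =>
    rw [ENNReal.tsum_add, ENNReal.tsum_mul_left, ENNReal.tsum_mul_left]
    calc _ ≤ (2⁻¹ : ℝ≥0∞) * 1 + 2⁻¹ * 1 := by gcongr
      _ = 1 := by simp [ENNReal.inv_two_add_inv_two]
  | @app M N D E F _ _ _ ihM ihN ihF =>
    calc ∑' U, ∑' V, ∑' W, D V * E W * F V W U
        = ∑' V, ∑' W, D V * E W * ∑' U, F V W U := by
          rw [ENNReal.tsum_comm]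
          refine tsum_congr fun V => ?_
          rw [ENNReal.tsum_comm]
          exact tsum_congr fun W => ENNReal.tsum_mul_left
      _ ≤ ∑' V, ∑' W, D V * E W := by
          refine ENNReal.tsum_le_tsum fun V => ENNReal.tsum_le_tsum fun W => ?_
          by_cases hV : D V = 0
          · simp [hV]
          by_cases hW : E W = 0
          · simp [hW]
          exact mul_le_of_le_one_right' (ihF V W hV hW)
      _ = (∑' V, D V) * ∑' W, E W := by
          simp_rw [ENNReal.tsum_mul_left, ENNReal.tsum_mul_right]
      _ ≤ 1 := mul_le_one' ihM ihN

/-- The convergence probability of `M`: the weight of `⟦M⟧`. -/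
noncomputable def convProb (M : Program) : ℝ := (∑' V : Value, sem M V).toReal

theorem convProb_mem (M : Program) : convProb M ∈ Set.Icc (0 : ℝ) 1 :=
  ⟨ENNReal.toReal_nonneg, ENNReal.toReal_le_of_le_ofReal zero_le_one
    (by simpa using (sem_spec M).weight_le_one)⟩

/-! ### Contexts -/

/-- Contexts `[·] | M | λx.C | C M | M C | C ⊕ C`. -/
inductive Ctx : Type
  | hole : Ctx
  | term (M : Term) : Ctx
  | lam (x : ℕ) (C : Ctx) : Ctx
  | appL (C : Ctx) (M : Term) : Ctx
  | appR (M : Term) (C : Ctx) : Ctx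
  | choice (C D : Ctx) : Ctx

/-- The affine formation judgement for contexts. -/
inductive AffineCtx : Finset ℕ → Ctx → Prop
  | hole {Γ : Finset ℕ} : AffineCtx Γ .hole
  | term {Γ : Finset ℕ} {M : Term} : Affine Γ M → AffineCtx Γ (.term M)
  | lam {Γ : Finset ℕ} {x : ℕ} {C : Ctx} : AffineCtx (insert x Γ) C → AffineCtx Γ (.lam x C)
  | appL {Γ Δ : Finset ℕ} {C : Ctx} {M : Term} :
      Disjoint Γ Δ → AffineCtx Γ C → Affine Δ M → AffineCtx (Γ ∪ Δ) (.appL C M)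
  | appR {Γ Δ : Finset ℕ} {M : Term} {C : Ctx} :
      Disjoint Γ Δ → Affine Γ M → AffineCtx Δ C → AffineCtx (Γ ∪ Δ) (.appR M C)
  | choice {Γ : Finset ℕ} {C D : Ctx} :
      AffineCtx Γ C → AffineCtx Γ D → AffineCtx Γ (.choice C D)

/-- `C.fill M` replaces every hole of `C` by the closed term `M`. -/
def Ctx.fill (M : Term) : Ctx → Term
  | .hole => M
  | .term N => N
  | .lam x C => .lam x (Ctx.fill M C)
  | .appL C N => .app (Ctx.fill M C) N
  | .appR N C => .app N (Ctx.fill M C)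
  | .choice C D => .choice (Ctx.fill M C) (Ctx.fill M D)

theorem AffineCtx.fill {Γ : Finset ℕ} {C : Ctx} (h : AffineCtx Γ C) {M : Term}
    (hM : Affine ∅ M) : Affine Γ (C.fill M) := by
  induction h with
  | hole => exact hM.weaken (Finset.empty_subset _)
  | term hN => exact hN
  | lam _ ih => exact .lam ih
  | appL hd _ hN ih => exact .app hd ih hN
  | appR hd hN _ ih => exact .app hd hN ih
  | choice _ _ ihC ihD => exact .choice ihC ihD

/-- Affine contexts without free variables: those for which `C[M]` is a program. -/
def ProgCtx : Type := {C : Ctx // AffineCtx ∅ C}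

/-- The program `C[M]`. -/
def ProgCtx.fill (C : ProgCtx) (M : Program) : Program := ⟨C.1.fill M.1, C.2.fill M.2⟩

/-- The context preorder. -/
def CtxLE (M N : Program) : Prop :=
  ∀ C : ProgCtx, convProb (C.fill M) ≤ convProb (C.fill N)

/-- Context equivalence. -/
def CtxEquiv (M N : Program) : Prop := CtxLE M N ∧ CtxLE N M

/-- The context distance. -/
noncomputable def ctxDist (M N : Program) : ℝ :=
  ⨆ C : ProgCtx, |convProb (C.fill M) - convProb (C.fill N)|

/-! ### Traces -/

/-- A trace `@V₁ ⋯ @Vₙ` is a finite sequence of values. -/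
abbrev Trace : Type := List Value

/-- Extend to programs a quantity `f` defined on values:
`f(V)` on a value `V`, and `∑_V ⟦M⟧(V) · f(V)` on a program `M` that is not a value. -/
noncomputable def extendToProgram (f : Value → ℝ≥0∞) : Program → ℝ≥0∞
  | ⟨.lam x L, h⟩ => f ⟨x, L, h⟩
  | M => ∑' V : Value, sem M V * f V

/-- Probability that a value accepts a trace:
`Pr(λx.L, ε) = 1` and `Pr(λx.L, @W · s) = Pr(L{W/x}, s)`. -/
noncomputable def valueTraceProb : Trace → Value → ℝ≥0∞
  | [], _ => 1
  | W :: s, V => extendToProgram (valueTraceProb s) (V.apply W)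

/-- Probability that a program accepts a trace, in `[0,∞]`. -/
noncomputable def traceProbENN (M : Program) (s : Trace) : ℝ≥0∞ :=
  extendToProgram (valueTraceProb s) M

theorem traceProbENN_value_nil (V : Value) : traceProbENN V.toProgram [] = 1 := rfl

theorem traceProbENN_value_cons (V W : Value) (s : Trace) :
    traceProbENN V.toProgram (W :: s) = traceProbENN (V.apply W) s := rfl

theorem traceProbENN_of_not_value (M : Program) (hM : ∀ V : Value, M ≠ V.toProgram) (s : Trace) :
    traceProbENN M s = ∑' V : Value, sem M V * traceProbENN V.toProgram s := by
  obtain ⟨M, h⟩ := M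
  cases M with
  | lam x L => exact absurd rfl (hM ⟨x, L, h⟩)
  | _ => rfl

theorem extendToProgram_le_one {f : Value → ℝ≥0∞} (hf : ∀ V, f V ≤ 1) (M : Program) :
    extendToProgram f M ≤ 1 := by
  have key : ∑' V : Value, sem M V * f V ≤ 1 :=
    (ENNReal.tsum_le_tsum fun V => mul_le_of_le_one_right' (hf V)).trans
      (sem_spec M).weight_le_one
  obtain ⟨M, h⟩ := M
  cases M with
  | lam x L => exact hf _
  | _ => exact key

theorem traceProbENN_le_one (M : Program) (s : Trace) : traceProbENN M s ≤ 1 := by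
  refine extendToProgram_le_one ?_ M
  induction s with
  | nil => exact fun _ => le_rfl
  | cons W s ih => exact fun V => extendToProgram_le_one ih _

/-- Probability that the program `M` accepts the trace `s`. -/
noncomputable def traceProb (M : Program) (s : Trace) : ℝ := (traceProbENN M s).toReal

theorem traceProb_mem (M : Program) (s : Trace) : traceProb M s ∈ Set.Icc (0 : ℝ) 1 :=
  ⟨ENNReal.toReal_nonneg, ENNReal.toReal_le_of_le_ofReal zero_le_one
    (by simpa using traceProbENN_le_one M s)⟩

/-- The trace preorder. -/
def TraceLE (M N : Program) : Prop := ∀ s : Trace, traceProb M s ≤ traceProb N s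

/-- Trace equivalence. -/
def TraceEquiv (M N : Program) : Prop := ∀ s : Trace, traceProb M s = traceProb N s

/-- The trace distance. -/
noncomputable def traceDist (M N : Program) : ℝ :=
  ⨆ s : Trace, |traceProb M s - traceProb N s|

/-- The supremum in `ctxDist` is a genuine one. -/
theorem bddAbove_ctxDist (M N : Program) :
    BddAbove (Set.range fun C : ProgCtx => |convProb (C.fill M) - convProb (C.fill N)|) := by
  refine ⟨1, ?_⟩
  rintro _ ⟨C, rfl⟩
  have h1 := convProb_mem (C.fill M)
  have h2 := convProb_mem (C.fill N)
  exact abs_sub_le_iff.2 ⟨by linarith [h1.2, h2.1], by linarith [h1.1, h2.2]⟩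

/-- The supremum in `traceDist` is a genuine one. -/
theorem bddAbove_traceDist (M N : Program) :
    BddAbove (Set.range fun s : Trace => |traceProb M s - traceProb N s|) := by
  refine ⟨1, ?_⟩
  rintro _ ⟨s, rfl⟩
  have h1 := traceProb_mem M s
  have h2 := traceProb_mem N s
  exact abs_sub_le_iff.2 ⟨by linarith [h1.2, h2.1], by linarith [h1.1, h2.2]⟩

end AffineLambda

open AffineLambda

open scoped ENNReal

namespace AffineLambda

/-! ### Equations for the semantics -/

/-! A trace `@V₁ ⋯ @Vₙ` is itself a context, namely `[·] V₁ ⋯ Vₙ`, so contexts discriminate at least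
as well as traces (`exists_ctx_convProb_eq_traceProb`).

Conversely, affineness lets each run of `C[M]` evaluate the hole at most once; the value it returns
can then be applied to closed values, and a residual context around it can again be treated as a
context. Hence `C` acts on `M` as a randomly chosen trace: there are weights `μ`, depending on `C`
only and of total at most 1, such that the convergence probability of `C[M]` is `∑ μ t * testProb M
t` (`ProgCtx.exists_mixture`). The extra test `none` accounts for runs that converge without
evaluating `M`; the empty trace would demand that `M` converges. Inequalities between trace
probabilities, also up to an additive error, pass through such a sum.

The mixture is found by strong induction on the rank of `C`, with the constant 1 generalised to a
continuation `f` applied to the resulting value (`ProgCtx.isMixture_expect_fill`). In an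
application, the continuation of the side with the hole evaluates the other side and performs the
call. That value either comes out of `M`, or is an abstraction `λx.K[M]` with `M` still suspended,
or does not depend on `M`; the fields of `Testable` cover these cases. A call involving a suspended
`M` leads to a context of smaller rank, since an affine substitution inserts its argument at most
once on each branch of a choice. -/

theorem BigStep.sem_eq {M : Program} {D : ValueDist} (h : BigStep M D) : sem M = D :=
  (sem_spec M).unique h

/-- The expectation of `f` under `⟦M⟧`. -/
noncomputable def expect (f : Value → ℝ≥0∞) (M : Program) : ℝ≥0∞ := ∑' U : Value, sem M U * f U

theorem expect_value (f : Value → ℝ≥0∞) (V : Value) : expect f V.toProgram = f V := by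
  rw [expect, (BigStep.value V).sem_eq, tsum_eq_single V]
  · simp [dirac]
  · intro U hU
    simp [dirac, hU]

theorem expect_choice (f : Value → ℝ≥0∞) (M N : Program) :
    expect f (M.choice N) = 2⁻¹ * expect f M + 2⁻¹ * expect f N := by
  simp only [expect, (BigStep.choice (sem_spec M) (sem_spec N)).sem_eq, add_mul, mul_assoc,
    ENNReal.tsum_add, ENNReal.tsum_mul_left]

theorem expect_app (f : Value → ℝ≥0∞) (M N : Program) :
    expect f (M.app N) = ∑' V : Value, ∑' W : Value, sem M V * sem N W * expect f (V.apply W) := by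
  have h := BigStep.app (sem_spec M) (sem_spec N) (F := fun V W => sem (V.apply W))
    (fun V W _ _ => sem_spec _)
  simp only [expect, h.sem_eq, ← ENNReal.tsum_mul_right, ← ENNReal.tsum_mul_left]
  rw [ENNReal.tsum_comm]
  refine tsum_congr fun V => ?_
  rw [ENNReal.tsum_comm]
  exact tsum_congr fun W => tsum_congr fun U => mul_assoc _ _ _

/-- The two sides of an application evaluate independently, so either one may be the outer
expectation. This form serves contexts with the hole in the function, `expect_app_right` those with
the hole in the argument. -/
theorem expect_app_left (f : Value → ℝ≥0∞) (M N : Program) :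
    expect f (M.app N) = expect (fun V => expect (fun W => expect f (V.apply W)) N) M := by
  rw [expect_app]
  simp only [expect, ← ENNReal.tsum_mul_left, mul_assoc]

theorem expect_app_right (f : Value → ℝ≥0∞) (M N : Program) :
    expect f (M.app N) = expect (fun W => expect (fun V => expect f (V.apply W)) M) N := by
  rw [expect_app, ENNReal.tsum_comm]
  simp only [expect, ← ENNReal.tsum_mul_left]
  exact tsum_congr fun W => tsum_congr fun V => tsum_congr fun U => by ring

theorem expect_le_one {f : Value → ℝ≥0∞} (hf : ∀ V, f V ≤ 1) (M : Program) : expect f M ≤ 1 :=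
  (ENNReal.tsum_le_tsum fun V => mul_le_of_le_one_right' (hf V)).trans (sem_spec M).weight_le_one

/-- Bounds the rank of the values that the hole-free side of an application can produce; with it,
the call has smaller rank than the application. -/
theorem rank_le_of_sem_ne_zero {M : Program} {V : Value} (h : sem M V ≠ 0) :
    V.toProgram.1.rank ≤ M.1.rank := by
  obtain ⟨D, hD, hr⟩ := BigStep.exists_of_rank _ M le_rfl
  exact hr V (by rwa [← hD.sem_eq])

theorem convProb_eq (M : Program) : convProb M = (expect (fun _ => 1) M).toReal := by
  simp [convProb, expect]

/-- The semantics of a value is a Dirac distribution, so the case split between values and other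
programs disappears. -/
theorem traceProbENN_eq_expect (M : Program) (s : Trace) :
    traceProbENN M s = expect (fun V => traceProbENN V.toProgram s) M := by
  by_cases h : ∃ V : Value, M = V.toProgram
  · obtain ⟨V, rfl⟩ := h
    rw [expect_value]
  · exact traceProbENN_of_not_value M (fun V hV => h ⟨V, hV⟩) s

theorem traceProbENN_nil (M : Program) : traceProbENN M [] = expect (fun _ => 1) M :=
  traceProbENN_eq_expect M []

theorem traceProbENN_cons (M : Program) (W : Value) (s : Trace) :
    traceProbENN M (W :: s) = expect (fun V => traceProbENN (V.apply W) s) M :=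
  traceProbENN_eq_expect M (W :: s)

/-! ### Traces as contexts -/

/-- The context `[·]`. -/
def ProgCtx.hole : ProgCtx := ⟨.hole, .hole⟩

/-- The context `C W`. -/
def ProgCtx.appValue (C : ProgCtx) (W : Value) : ProgCtx :=
  ⟨.appL C.1 W.toProgram.1, .appL (Finset.disjoint_empty_left ∅) C.2 W.toProgram.2⟩

theorem ProgCtx.fill_appValue (C : ProgCtx) (W : Value) (M : Program) :
    (C.appValue W).fill M = (C.fill M).app W.toProgram := rfl

/-- The context `C V₁ ⋯ Vₙ`. -/
def ProgCtx.appTrace (C : ProgCtx) : Trace → ProgCtx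
  | [] => C
  | W :: s => ProgCtx.appTrace (C.appValue W) s

/-- `appTrace` accumulates the applications in `C`, so the induction on `s` needs `C` arbitrary. -/
theorem expect_appTrace (M : Program) (s : Trace) (C : ProgCtx) :
    expect (fun _ => 1) ((C.appTrace s).fill M) = traceProbENN (C.fill M) s := by
  induction s generalizing C with
  | nil => exact (traceProbENN_nil _).symm
  | cons W s ih =>
    rw [ProgCtx.appTrace, ih, C.fill_appValue, traceProbENN_eq_expect, expect_app_left, traceProbENN_cons]
    congr 1
    funext V
    rw [expect_value, ← traceProbENN_eq_expect]

theorem exists_ctx_convProb_eq_traceProb (s : Trace) :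
    ∃ C : ProgCtx, ∀ M : Program, convProb (C.fill M) = traceProb M s := by
  refine ⟨ProgCtx.hole.appTrace s, fun M => ?_⟩
  rw [convProb_eq, expect_appTrace]
  rfl

/-! ### Substitution and contexts -/

/-- The size of a context, with a hole counted as a variable. -/
def Ctx.rank : Ctx → ℕ
  | .hole => 1
  | .term M => M.rank
  | .lam _ C => C.rank + 1
  | .appL C M => C.rank + M.rank + 1
  | .appR M C => M.rank + C.rank + 1
  | .choice C D => max C.rank D.rank + 1

theorem AffineCtx.weaken {Γ : Finset ℕ} {C : Ctx} (h : AffineCtx Γ C) :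
    ∀ {Γ' : Finset ℕ}, Γ ⊆ Γ' → AffineCtx Γ' C := by
  induction h with
  | hole => intro Γ' _; exact .hole
  | term hM => intro Γ' hs; exact .term (hM.weaken hs)
  | lam _ ih => intro Γ' hs; exact .lam (ih (Finset.insert_subset_insert _ hs))
  | @appL Γ Δ C N hd _ hN ih =>
    intro Γ' hs
    have hΔ : Δ ⊆ Γ' := Finset.union_subset_right hs
    have hΓ : Γ ⊆ Γ' \ Δ :=
      Finset.subset_sdiff.2 ⟨Finset.union_subset_left hs, hd⟩
    have := AffineCtx.appL (Finset.sdiff_disjoint (s := Δ) (t := Γ')) (ih hΓ) hN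
    rwa [Finset.sdiff_union_of_subset hΔ] at this
  | @appR Γ Δ N C hd hN _ ih =>
    intro Γ' hs
    have hΓ : Γ ⊆ Γ' := Finset.union_subset_left hs
    have hΔ : Δ ⊆ Γ' \ Γ :=
      Finset.subset_sdiff.2 ⟨Finset.union_subset_right hs, hd.symm⟩
    have := AffineCtx.appR (Finset.disjoint_sdiff (s := Γ) (t := Γ')) hN (ih hΔ)
    rwa [Finset.union_sdiff_of_subset hΓ] at this
  | choice _ _ ihC ihD => intro Γ' hs; exact .choice (ihC hs) (ihD hs)

/-- The context `C{V/x}`. -/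
theorem AffineCtx.exists_subst {Γ : Finset ℕ} {C : Ctx} (h : AffineCtx Γ C) (x : ℕ) {V : Term}
    (hV : Affine ∅ V) : ∃ C' : Ctx, AffineCtx (Γ.erase x) C' ∧ C'.rank ≤ C.rank + V.rank ∧
      ∀ M : Term, Affine ∅ M → C'.fill M = (C.fill M).subst x V := by
  induction h with
  | hole =>
    -- The hole only receives closed terms, which substitution leaves unchanged.
    exact ⟨.hole, .hole, by simp [Ctx.rank],
      fun M hM => (hM.subst_eq_self (Finset.notMem_empty x) V).symm⟩
  | @term Γ N hN =>
    exact ⟨.term (N.subst x V), .term (hN.subst x hV), hN.rank_subst_le x V, fun _ _ => rfl⟩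
  | @lam Γ y C hC ih =>
    by_cases hyx : y = x
    · subst hyx
      refine ⟨.lam y C, .lam (hC.weaken ?_), by simp, fun M _ => by simp [Ctx.fill, Term.subst]⟩
      intro a ha
      simp only [Finset.mem_insert, Finset.mem_erase] at ha ⊢
      tauto
    · obtain ⟨C', h1, h2, h3⟩ := ih
      rw [Finset.erase_insert_of_ne hyx] at h1
      exact ⟨.lam y C', .lam h1, by simp only [Ctx.rank]; omega,
        fun M hM => by simp [Ctx.fill, Term.subst, hyx, h3 M hM]⟩
  | @appL Γ Δ C N hd hC hN ih =>
    have hd' := hd.mono (Finset.erase_subset x Γ) (Finset.erase_subset x Δ)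
    rw [Finset.erase_union_distrib]
    -- Only one side of an affine application can contain `x`, so the rank of `V` is paid for once.
    by_cases hx : x ∈ Γ
    · obtain ⟨C', h1, h2, h3⟩ := ih
      have hN' := hN.subst_eq_self (Finset.disjoint_left.1 hd hx) V
      refine ⟨.appL C' (N.subst x V), .appL hd' h1 (hN.subst x hV), ?_,
        fun M hM => by simp [Ctx.fill, Term.subst, h3 M hM]⟩
      rw [hN']
      simp only [Ctx.rank]
      omega
    · refine ⟨.appL C (N.subst x V), .appL hd' ?_ (hN.subst x hV), ?_, fun M hM => ?_⟩
      · rwa [Finset.erase_eq_of_notMem hx]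
      · have := hN.rank_subst_le x V
        simp only [Ctx.rank]
        omega
      · simp [Ctx.fill, Term.subst, (hC.fill hM).subst_eq_self hx V]
  | @appR Γ Δ N C hd hN hC ih =>
    have hd' := hd.mono (Finset.erase_subset x Γ) (Finset.erase_subset x Δ)
    rw [Finset.erase_union_distrib]
    by_cases hx : x ∈ Γ
    · have hx' := Finset.disjoint_left.1 hd hx
      refine ⟨.appR (N.subst x V) C, .appR hd' (hN.subst x hV) ?_, ?_, fun M hM => ?_⟩
      · rwa [Finset.erase_eq_of_notMem hx']
      · have := hN.rank_subst_le x V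
        simp only [Ctx.rank]
        omega
      · simp [Ctx.fill, Term.subst, (hC.fill hM).subst_eq_self hx' V]
    · obtain ⟨C', h1, h2, h3⟩ := ih
      have hN' := hN.subst_eq_self hx V
      refine ⟨.appR (N.subst x V) C', .appR hd' (hN.subst x hV) h1, ?_,
        fun M hM => by simp [Ctx.fill, Term.subst, h3 M hM]⟩
      rw [hN']
      simp only [Ctx.rank]
      omega
  | choice _ _ ihC ihD =>
    obtain ⟨C', h1, h2, h3⟩ := ihC
    obtain ⟨D', k1, k2, k3⟩ := ihD
    exact ⟨.choice C' D', .choice h1 k1, by simp only [Ctx.rank]; omega,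
      fun M hM => by simp [Ctx.fill, Term.subst, h3 M hM, k3 M hM]⟩

/-- The context `L{K/x}`. -/
theorem Affine.exists_substCtx {Γ : Finset ℕ} {L : Term} (h : Affine Γ L) (x : ℕ) {K : Ctx}
    (hK : AffineCtx ∅ K) : ∃ C : Ctx, AffineCtx (Γ.erase x) C ∧ C.rank ≤ L.rank + K.rank ∧
      ∀ M : Term, C.fill M = L.subst x (K.fill M) := by
  induction h with
  | @var Γ y hy =>
    by_cases hyx : y = x
    · exact ⟨K, hK.weaken (Finset.empty_subset _), by simp, fun M => by simp [Term.subst, hyx]⟩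
    · exact ⟨.term (.var y), .term (.var (Finset.mem_erase.2 ⟨hyx, hy⟩)), by simp [Ctx.rank],
        fun M => by simp [Ctx.fill, Term.subst, hyx]⟩
  | @lam Γ y L hL ih =>
    by_cases hyx : y = x
    · subst hyx
      refine ⟨.term (.lam y L), .term (.lam (hL.weaken ?_)), by simp [Ctx.rank],
        fun M => by simp [Ctx.fill, Term.subst]⟩
      intro a ha
      simp only [Finset.mem_insert, Finset.mem_erase] at ha ⊢
      tauto
    · obtain ⟨C', h1, h2, h3⟩ := ih
      rw [Finset.erase_insert_of_ne hyx] at h1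
      exact ⟨.lam y C', .lam h1, by simp only [Ctx.rank, Term.rank]; omega,
        fun M => by simp [Ctx.fill, Term.subst, hyx, h3 M]⟩
  | @app Γ Δ P Q hd hP hQ ihP ihQ =>
    have hd' := hd.mono (Finset.erase_subset x Γ) (Finset.erase_subset x Δ)
    rw [Finset.erase_union_distrib]
    -- A context has no application with holes on both sides; affineness ensures that `K` is needed
    -- on one side only.
    by_cases hx : x ∈ Γ
    · have hx' := Finset.disjoint_left.1 hd hx
      obtain ⟨C', h1, h2, h3⟩ := ihP
      refine ⟨.appL C' Q, .appL hd' h1 ?_, by simp only [Ctx.rank, Term.rank]; omega,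
        fun M => by simp [Ctx.fill, Term.subst, h3 M, hQ.subst_eq_self hx']⟩
      rwa [Finset.erase_eq_of_notMem hx']
    · obtain ⟨C', h1, h2, h3⟩ := ihQ
      refine ⟨.appR P C', .appR hd' ?_ h1, by simp only [Ctx.rank, Term.rank]; omega,
        fun M => by simp [Ctx.fill, Term.subst, h3 M, hP.subst_eq_self hx]⟩
      rwa [Finset.erase_eq_of_notMem hx]
  | choice _ _ ihP ihQ =>
    obtain ⟨C', h1, h2, h3⟩ := ihP
    obtain ⟨D', k1, k2, k3⟩ := ihQ
    exact ⟨.choice C' D', .choice h1 k1, by simp only [Ctx.rank, Term.rank]; omega,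
      fun M => by simp [Ctx.fill, Term.subst, h3 M, k3 M]⟩
  | omega => exact ⟨.term .omega, .term .omega, by simp [Ctx.rank], fun _ => rfl⟩

/-! ### Mixtures of trace probabilities -/

/-- Acceptance probability of an optional trace: `none` is the test that always succeeds. -/
noncomputable def testProb (M : Program) : Option Trace → ℝ≥0∞
  | none => 1
  | some s => traceProbENN M s

/-- The map `i ↦ φ (P i)` is the acceptance probability by `P i` of a random test. -/
def IsMixture {ι : Type} (P : ι → Program) (φ : ι → ℝ≥0∞) : Prop :=
  ∃ μ : Option Trace → ℝ≥0∞, ∑' t, μ t ≤ 1 ∧ ∀ i, φ i = ∑' t, μ t * testProb (P i) t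

section IsMixture

variable {ι : Type} {P : ι → Program}

theorem IsMixture.test (t : Option Trace) : IsMixture P (fun i => testProb (P i) t) := by
  classical
  refine ⟨Pi.single t 1, by simp, fun i => ?_⟩
  rw [tsum_eq_single t]
  · simp
  · intro t' ht
    simp [Pi.single_eq_of_ne ht]

/-- Drawing `k` with weight `w k` and then a test for `φ k` is again a random test; the mixing
weights are `∑' k, w k * μ k t`. -/
theorem IsMixture.tsum {κ : Type} {w : κ → ℝ≥0∞} (hw : ∑' k, w k ≤ 1) {φ : κ → ι → ℝ≥0∞}
    (h : ∀ k, w k ≠ 0 → IsMixture P (φ k)) : IsMixture P (fun i => ∑' k, w k * φ k i) := by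
  have h' : ∀ k, ∃ μ : Option Trace → ℝ≥0∞, w k ≠ 0 →
      ∑' t, μ t ≤ 1 ∧ ∀ i, φ k i = ∑' t, μ t * testProb (P i) t := by
    intro k
    by_cases hk : w k = 0
    -- An arbitrary default: these weights get multiplied by `w k = 0`.
    · exact ⟨0, fun hk' => absurd hk hk'⟩
    · obtain ⟨μ, hμ⟩ := h k hk
      exact ⟨μ, fun _ => hμ⟩
  choose μ hμ using h'
  refine ⟨fun t => ∑' k, w k * μ k t, ?_, fun i => ?_⟩
  · rw [ENNReal.tsum_comm]
    refine (ENNReal.tsum_le_tsum fun k => ?_).trans hw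
    rw [ENNReal.tsum_mul_left]
    by_cases hk : w k = 0
    · simp [hk]
    · exact mul_le_of_le_one_right' (hμ k hk).1
  · simp only [← ENNReal.tsum_mul_right]
    rw [ENNReal.tsum_comm]
    refine tsum_congr fun k => ?_
    by_cases hk : w k = 0
    · simp [hk]
    · rw [(hμ k hk).2 i, ← ENNReal.tsum_mul_left]
      exact tsum_congr fun t => (mul_assoc _ _ _).symm

theorem IsMixture.const {c : ℝ≥0∞} (hc : c ≤ 1) : IsMixture P (fun _ => c) := by
  have := IsMixture.tsum (P := P) (κ := Unit) (w := fun _ => c) (by simpa using hc)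
    (φ := fun _ i => testProb (P i) none) (fun _ _ => IsMixture.test none)
  simpa [testProb] using this

theorem IsMixture.average {φ ψ : ι → ℝ≥0∞} (hφ : IsMixture P φ) (hψ : IsMixture P ψ) :
    IsMixture P (fun i => 2⁻¹ * φ i + 2⁻¹ * ψ i) := by
  have := IsMixture.tsum (P := P) (κ := Bool) (w := fun _ => 2⁻¹)
    (by simp)
    (φ := fun b => if b then φ else ψ) (fun b _ => by cases b <;> simpa)
  simpa [tsum_bool, add_comm] using this

theorem IsMixture.comp {φ : ι → ℝ≥0∞} (h : IsMixture P φ) {κ : Type} (g : κ → ι) :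
    IsMixture (P ∘ g) (φ ∘ g) := by
  obtain ⟨μ, h1, h2⟩ := h
  exact ⟨μ, h1, fun k => h2 (g k)⟩

theorem IsMixture.expect {M : Program} {φ : Value → ι → ℝ≥0∞}
    (h : ∀ W, sem M W ≠ 0 → IsMixture P (φ W)) :
    IsMixture P (fun i => expect (fun W => φ W i) M) :=
  IsMixture.tsum (sem_spec M).weight_le_one h

end IsMixture

/-- Evaluating a program before running a random test is a random test. -/
theorem IsMixture.expect_program {f : Value → ℝ≥0∞} (h : IsMixture Value.toProgram f) :
    IsMixture id (AffineLambda.expect f) := by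
  obtain ⟨μ, h1, h2⟩ := h
  -- Exchanging the sums draws the test before the program is evaluated, leaving one fixed test to
  -- treat at a time.
  have key : AffineLambda.expect f = fun M => ∑' t, μ t *
      AffineLambda.expect (fun V => testProb V.toProgram t) M := by
    funext M
    simp only [AffineLambda.expect, h2, ← ENNReal.tsum_mul_left]
    rw [ENNReal.tsum_comm]
    exact tsum_congr fun t => tsum_congr fun V => by ring
  rw [key]
  refine IsMixture.tsum h1 fun t _ => ?_
  cases t with
  | none =>
    -- The always successful test, run after evaluating `M`, succeeds exactly when `M` converges: it
    -- becomes the empty trace.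
    convert IsMixture.test (P := id) (some []) using 2 with M
    exact (traceProbENN_nil M).symm
  | some s =>
    convert IsMixture.test (P := id) (some s) using 2 with M
    exact (traceProbENN_eq_expect M s).symm

/-- Applying a value to an argument before running a random test is a random test. -/
theorem IsMixture.apply {φ : Program → ℝ≥0∞} (h : IsMixture id φ) (W : Value) :
    IsMixture Value.toProgram (fun V => φ (V.apply W)) := by
  obtain ⟨μ, h1, h2⟩ := h
  simp only [h2]
  refine IsMixture.tsum h1 fun t _ => ?_
  cases t with
  | none => exact IsMixture.test none
  -- Passing `W` first prefixes the trace with `@W`.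
  | some s => exact IsMixture.test (some (W :: s))

/-! ### Evaluation in context -/

/-- The value `λx.K[M]`. -/
def lamCtxValue {x : ℕ} {K : Ctx} (hK : AffineCtx ∅ (.lam x K)) (M : Program) : Value :=
  ⟨x, K.fill M.1, hK.fill M.2⟩

/-- A continuation `f` is testable up to `n` if it sends the value in the hole, and value contexts
`λx.K` of rank at most `n`, to random tests. -/
structure Testable (f : Value → ℝ≥0∞) (n : ℕ) : Prop where
  le_one : ∀ V, f V ≤ 1
  value : IsMixture Value.toProgram f
  lam : ∀ {x : ℕ} {K : Ctx} (hK : AffineCtx ∅ (.lam x K)), (Ctx.lam x K).rank ≤ n →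
    IsMixture id (fun M => f (lamCtxValue hK M))

theorem Testable.mono {f : Value → ℝ≥0∞} {m n : ℕ} (h : Testable f n) (hmn : m ≤ n) :
    Testable f m :=
  ⟨h.le_one, h.value, fun hK hr => h.lam hK (hr.trans hmn)⟩

theorem AffineCtx.lam_inv {Γ : Finset ℕ} {x : ℕ} {C : Ctx} (h : AffineCtx Γ (.lam x C)) :
    AffineCtx (insert x Γ) C := by
  cases h
  assumption

theorem AffineCtx.choice_inv {Γ : Finset ℕ} {C D : Ctx} (h : AffineCtx Γ (.choice C D)) :
    AffineCtx Γ C ∧ AffineCtx Γ D := by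
  cases h
  constructor <;> assumption

theorem AffineCtx.term_inv {Γ : Finset ℕ} {M : Term} (h : AffineCtx Γ (.term M)) :
    Affine Γ M := by
  cases h
  assumption

theorem AffineCtx.appL_inv {C : Ctx} {M : Term} (h : AffineCtx ∅ (.appL C M)) :
    AffineCtx ∅ C ∧ Affine ∅ M := by
  generalize hP : Ctx.appL C M = P at h
  generalize hΓ : (∅ : Finset ℕ) = Γ at h
  cases h with
  | appL _ h1 h2 =>
    cases hP
    obtain ⟨e1, e2⟩ := Finset.union_eq_empty.1 hΓ.symm
    subst e1 e2
    exact ⟨h1, h2⟩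
  | hole | term | lam | appR | choice => cases hP

theorem AffineCtx.appR_inv {C : Ctx} {M : Term} (h : AffineCtx ∅ (.appR M C)) :
    Affine ∅ M ∧ AffineCtx ∅ C := by
  generalize hP : Ctx.appR M C = P at h
  generalize hΓ : (∅ : Finset ℕ) = Γ at h
  cases h with
  | appR _ h1 h2 =>
    cases hP
    obtain ⟨e1, e2⟩ := Finset.union_eq_empty.1 hΓ.symm
    subst e1 e2
    exact ⟨h1, h2⟩
  | hole | term | lam | appL | choice => cases hP

/-- `(λx.K[M]) W` reduces to a context filled with `M`. -/
theorem exists_ctx_lamCtxValue_apply {x : ℕ} {K : Ctx} (hK : AffineCtx ∅ (.lam x K)) (W : Value) :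
    ∃ C : ProgCtx, C.1.rank < (Ctx.lam x K).rank + W.toProgram.1.rank ∧
      ∀ M : Program, (lamCtxValue hK M).apply W = C.fill M := by
  obtain ⟨C, h1, h2, h3⟩ := hK.lam_inv.exists_subst x W.toProgram.2
  refine ⟨⟨C, by simpa using h1⟩, ?_, fun M => Subtype.ext (h3 M.1 M.2).symm⟩
  simp only [Ctx.rank]
  omega

/-- `V K[M]` reduces to a context filled with `M`, if `K[M]` is a value. -/
theorem exists_ctx_apply (V : Value) (K : ProgCtx) :
    ∃ C : ProgCtx, C.1.rank < V.toProgram.1.rank + K.1.rank ∧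
      ∀ (M : Program) (W : Value), W.toProgram = K.fill M → V.apply W = C.fill M := by
  obtain ⟨C, h1, h2, h3⟩ := V.affine.lam_inv.exists_substCtx V.binder K.2
  refine ⟨⟨C, by simpa using h1⟩, ?_, fun M W hW => Subtype.ext ?_⟩
  · simp only [Value.toProgram, Term.rank]
    omega
  · simp only [Value.apply, hW, ProgCtx.fill, h3]

/-- The expectation of a testable continuation after evaluating `C[M]` is a random test of `M`. -/
theorem ProgCtx.isMixture_expect_fill (C : ProgCtx) {f : Value → ℝ≥0∞}
    (hf : Testable f C.1.rank) : IsMixture id (fun M => expect f (C.fill M)) := by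
  induction hn : C.1.rank using Nat.strong_induction_on generalizing C f with
  | _ n ih =>
  obtain ⟨C, hC⟩ := C
  simp only at hn hf
  cases C with
  | hole => exact hf.value.expect_program
  | term N => exact IsMixture.const (expect_le_one hf.le_one ⟨N, hC.term_inv⟩)
  | lam x K =>
    convert hf.lam hC le_rfl using 2 with M
    exact expect_value f (lamCtxValue hC M)
  | choice A B =>
    obtain ⟨hA, hB⟩ := hC.choice_inv
    simp only [Ctx.rank] at hn hf
    have h := (ih A.rank (by omega) ⟨A, hA⟩ (hf.mono (by simp only; omega)) rfl).average
      (ih B.rank (by omega) ⟨B, hB⟩ (hf.mono (by simp only; omega)) rfl)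
    convert h using 2 with M
    exact expect_choice f ⟨A.fill M.1, hA.fill M.2⟩ ⟨B.fill M.1, hB.fill M.2⟩
  | appL A N =>
    obtain ⟨hA, hN⟩ := hC.appL_inv
    simp only [Ctx.rank] at hn hf
    let Q : Program := ⟨N, hN⟩
    -- The continuation of `A`: evaluate `Q`, call `V` on the result, continue with `f`. For a value
    -- `V` coming out of the hole, the call extends the trace; for `λx.K[M]`, it gives a context of
    -- rank below `A.rank + N.rank`, within reach of the induction.
    have hg : Testable (fun V => expect (fun W => expect f (V.apply W)) Q) A.rank := by
      refine ⟨fun V => expect_le_one (fun W => expect_le_one hf.le_one _) _,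
        IsMixture.expect fun W _ => hf.value.expect_program.apply W, fun {x K} hK hr => ?_⟩
      refine IsMixture.expect (φ := fun W M => expect f ((lamCtxValue hK M).apply W))
        fun W hW => ?_
      have hW' : W.toProgram.1.rank ≤ N.rank := rank_le_of_sem_ne_zero hW
      obtain ⟨D, hD, hD'⟩ := exists_ctx_lamCtxValue_apply hK W
      simp only [hD']
      exact ih D.1.rank (by omega) D (hf.mono (by omega)) rfl
    convert ih A.rank (by omega) ⟨A, hA⟩ hg rfl using 2 with M
    exact expect_app_left f ⟨A.fill M.1, hA.fill M.2⟩ Q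
  | appR N A =>
    obtain ⟨hN, hA⟩ := hC.appR_inv
    simp only [Ctx.rank] at hn hf
    let Q : Program := ⟨N, hN⟩
    have hA1 : 1 ≤ A.rank := by
      have hpos : ∀ T : Term, 1 ≤ T.rank := fun T => by cases T <;> simp [Term.rank]
      cases A <;> simp [Ctx.rank, hpos]
    have hg : Testable (fun W => expect (fun V => expect f (V.apply W)) Q) A.rank := by
      refine ⟨fun V => expect_le_one (fun W => expect_le_one hf.le_one _) _,
        IsMixture.expect fun V hV => ?_, fun {x K} hK hr => ?_⟩
      · have hV' : V.toProgram.1.rank ≤ N.rank := rank_le_of_sem_ne_zero hV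
        -- Here the value `W` out of the hole is the argument: the body of `V` with a hole in place
        -- of its bound variable is a context around `W`. The induction tests all programs in that
        -- context, and `IsMixture.comp` restricts to values.
        obtain ⟨D, hD, hD'⟩ := exists_ctx_apply V ProgCtx.hole
        simp only [ProgCtx.hole, Ctx.rank] at hD
        have h := (ih D.1.rank (by omega) D (hf.mono (by omega)) rfl).comp Value.toProgram
        have heq : (fun W => expect f (V.apply W))
            = (fun M => expect f (D.fill M)) ∘ Value.toProgram := by
          funext W
          exact congrArg (expect f) (hD' W.toProgram W rfl)
        rw [heq]
        exact h
      · refine IsMixture.expect (φ := fun V M => expect f (V.apply (lamCtxValue hK M)))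
          fun V hV => ?_
        have hV' : V.toProgram.1.rank ≤ N.rank := rank_le_of_sem_ne_zero hV
        -- The argument `λx.K[M]` is substituted unevaluated inside, so `M` now sits in the body of
        -- `V` with `λx.K` plugged in.
        obtain ⟨D, hD, hD'⟩ := exists_ctx_apply V ⟨.lam x K, hK⟩
        simp only at hD
        convert ih D.1.rank (by omega) D (hf.mono (by omega)) rfl using 2 with M
        exact congrArg (expect f) (hD' M (lamCtxValue hK M) rfl)
    convert ih A.rank (by omega) ⟨A, hA⟩ hg rfl using 2 with M
    exact expect_app_right f Q ⟨A.fill M.1, hA.fill M.2⟩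

/-- The convergence probability of `C[M]` is the acceptance probability by `M` of a random test
that depends on `C` only. -/
theorem ProgCtx.exists_mixture (C : ProgCtx) :
    ∃ μ : Option Trace → ℝ≥0∞, ∑' t, μ t ≤ 1 ∧
      ∀ M, expect (fun _ => 1) (C.fill M) = ∑' t, μ t * testProb M t :=
  C.isMixture_expect_fill ⟨fun _ => le_rfl, IsMixture.const le_rfl,
    fun _ _ => IsMixture.const le_rfl⟩

/-! ### Comparison of contexts and traces -/

theorem traceProbENN_ne_top (M : Program) (s : Trace) : traceProbENN M s ≠ ∞ :=
  ((traceProbENN_le_one M s).trans_lt ENNReal.one_lt_top).ne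

/-- A one-sided bound with an error serves both comparisons: `δ = 0` gives the preorder, and `δ =
traceDist M N` used in both directions gives the distance. The error is not amplified because the
weights of the mixture sum to at most 1. -/
theorem convProb_le_add_of_traceProb_le_add {M N : Program} {δ : ℝ} (hδ : 0 ≤ δ)
    (h : ∀ s, traceProb M s ≤ traceProb N s + δ) (C : ProgCtx) :
    convProb (C.fill M) ≤ convProb (C.fill N) + δ := by
  obtain ⟨μ, h1, h2⟩ := C.exists_mixture
  have htest : ∀ t, testProb M t ≤ testProb N t + ENNReal.ofReal δ := by
    rintro (_ | s)
    · exact le_self_add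
    · have := ENNReal.ofReal_le_ofReal (h s)
      rwa [ENNReal.ofReal_add (traceProb_mem N s).1 hδ, traceProb, traceProb,
        ENNReal.ofReal_toReal (traceProbENN_ne_top M s),
        ENNReal.ofReal_toReal (traceProbENN_ne_top N s)] at this
  have key : expect (fun _ => 1) (C.fill M)
      ≤ expect (fun _ => 1) (C.fill N) + ENNReal.ofReal δ := by
    rw [h2, h2]
    calc ∑' t, μ t * testProb M t
        ≤ ∑' t, (μ t * testProb N t + μ t * ENNReal.ofReal δ) :=
          ENNReal.tsum_le_tsum fun t => by
            rw [← mul_add]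
            exact mul_le_mul_right (htest t) _
      _ ≤ ∑' t, μ t * testProb N t + ENNReal.ofReal δ := by
          rw [ENNReal.tsum_add, ENNReal.tsum_mul_right]
          exact add_le_add_right (mul_le_of_le_one_left' h1) _
  have hN : expect (fun _ => 1) (C.fill N) ≠ ∞ :=
    ((expect_le_one (fun _ => le_rfl) _).trans_lt ENNReal.one_lt_top).ne
  rw [convProb_eq, convProb_eq, ← ENNReal.toReal_ofReal hδ,
    ← ENNReal.toReal_add hN ENNReal.ofReal_ne_top]
  exact ENNReal.toReal_mono (ENNReal.add_ne_top.2 ⟨hN, ENNReal.ofReal_ne_top⟩) key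

theorem ctxLE_iff_traceLE (M N : Program) : CtxLE M N ↔ TraceLE M N := by
  refine ⟨fun h s => ?_, fun h C => ?_⟩
  · obtain ⟨C, hC⟩ := exists_ctx_convProb_eq_traceProb s
    rw [← hC, ← hC]
    exact h C
  · simpa using convProb_le_add_of_traceProb_le_add le_rfl (fun s => by simpa using h s) C

theorem ctxEquiv_iff_traceEquiv (M N : Program) : CtxEquiv M N ↔ TraceEquiv M N := by
  rw [CtxEquiv, ctxLE_iff_traceLE, ctxLE_iff_traceLE]
  exact ⟨fun h s => le_antisymm (h.1 s) (h.2 s), fun h => ⟨fun s => (h s).le, fun s => (h s).ge⟩⟩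

theorem ctxDist_eq_traceDist (M N : Program) : ctxDist M N = traceDist M N := by
  have : Nonempty ProgCtx := ⟨⟨.hole, .hole⟩⟩
  have hle : ∀ s, |traceProb M s - traceProb N s| ≤ traceDist M N :=
    le_ciSup (bddAbove_traceDist M N)
  -- The comparison lemma needs `0 ≤ δ`; the empty trace witnesses it.
  have h0 : 0 ≤ traceDist M N := (abs_nonneg _).trans (hle [])
  refine le_antisymm (ciSup_le fun C => ?_) (ciSup_le fun s => ?_)
  · have h1 := convProb_le_add_of_traceProb_le_add (M := M) (N := N) h0
      (fun s => by linarith [(abs_sub_le_iff.1 (hle s)).1]) C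
    have h2 := convProb_le_add_of_traceProb_le_add (M := N) (N := M) h0
      (fun s => by linarith [(abs_sub_le_iff.1 (hle s)).2]) C
    exact abs_sub_le_iff.2 ⟨by linarith, by linarith⟩
  · obtain ⟨C, hC⟩ := exists_ctx_convProb_eq_traceProb s
    rw [← hC, ← hC]
    exact le_ciSup (bddAbove_ctxDist M N) C

end AffineLambda

open AffineLambda
theorem mainTheorem2 :
    (∀ M N : Program, ctxDist M N = traceDist M N) ∧
    (∀ M N : Program, CtxLE M N ↔ TraceLE M N) ∧
    (∀ M N : Program, CtxEquiv M N ↔ TraceEquiv M N) :=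
  ⟨ctxDist_eq_traceDist, ctxLE_iff_traceLE, ctxEquiv_iff_traceEquiv⟩
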